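/- Let $\mathcal H$ be a complex Hilbert space and let $H\ge 0$ be a (possibly unbounded) self-adjoint operator on $\mathcal H$. Operators $A$ below are symmetric with $\operatorname{dom}(H)\subseteq\operatorname{dom}(A)$. For such $A$ let $\delta(A)=i[H,A]$, where the commutator is understood through its sesquilinear form: $\psi\in\operatorname{dom}(H)$ lies in the domain of $\delta(A)$, with $\delta(A)\psi=\chi$, if $$\langle\varphi,\chi\rangle=i\big(\langle H\varphi,A\psi\rangle-\langle A\varphi,H\psi\rangle\big)\qquad\text{for all }\varphi\in\operatorname{dom}(H);$$ this extends the operator $i(HA-AH)$. If $\delta(A)$ is defined on all of $\operatorname{dom}(H)$, it is again symmetric, and one can form $\delta^2(A)=\delta(\delta(A))$, and so on; $\delta^0(A)=A$. Say that an operator $T$ is bounded relative to $H+1$ if it is defined on $\operatorname{dom}(H)$ and there is a constant $C$ with $\|T\psi\|\le C\|(H+1)\psi\|$ for all $\psi\in\operatorname{dom}(H)$. (1) If $A$ is symmetric and $A$, $\delta(A)$, $\delta^2(A)$ are bounded relative to $H+1$, then $A$ is essentially self-adjoint on every core $D$ of $H$, that is, the closure of $A|_D$ is self-adjoint. (2)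 Let $A,B$ be symmetric, and suppose that $A,\delta(A),\delta^2(A),\delta^3(A)$ and $B,\delta(B),\delta^2(B),\delta^3(B)$ are bounded relative to $H+1$. Suppose furthermore that $AB$ and $BA$ are defined on $\operatorname{dom}(H)$ (that is, $B\operatorname{dom}(H)\subseteq\operatorname{dom}(A)$ and $A\operatorname{dom}(H)\subseteq\operatorname{dom}(B)$) and $AB\psi=BA\psi$ for all $\psi\in\operatorname{dom}(H)$. Then $A$ and $B$ are essentially self-adjoint on every core of $H$, and their closures commute strongly, that is, the unitary groups generated by them satisfy $e^{is\overline A}e^{it\overline B}=e^{it\overline B}e^{is\overline A}$ for all $s,t\in\mathbb R$. -/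

import Mathlib

namespace UnboundedOp

variable {E : Type*} [NormedAddCommGroup E] [InnerProductSpace ℂ E]

/-- The graph of the commutator `δ(A) = i[H, A]`. A pair `(ψ, χ)` belongs to it if `ψ` lies in
`dom H ∩ dom A` and `⟨φ, χ⟩ = i (⟨Hφ, Aψ⟩ - ⟨Aφ, Hψ⟩)` for every `φ` in `dom H ∩ dom A`, that is,
if `χ` represents the sesquilinear form `i[H, A]` of the symmetric operators `H`, `A` at `ψ`. -/
def deltaGraph (H A : E →ₗ.[ℂ] E) : Submodule ℂ (E × E) where
  carrier := {p | ∃ (hH : p.1 ∈ H.domain) (hA : p.1 ∈ A.domain),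
    ∀ (φ : E) (hφH : φ ∈ H.domain) (hφA : φ ∈ A.domain),
      inner ℂ φ p.2 = Complex.I *
        (inner ℂ (H ⟨φ, hφH⟩) (A ⟨p.1, hA⟩) - inner ℂ (A ⟨φ, hφA⟩) (H ⟨p.1, hH⟩))}
  zero_mem' := by
    refine ⟨H.domain.zero_mem, A.domain.zero_mem, fun φ hφH hφA => ?_⟩
    have h1 : A ⟨(0 : E × E).1, A.domain.zero_mem⟩ = 0 := A.map_zero
    have h2 : H ⟨(0 : E × E).1, H.domain.zero_mem⟩ = 0 := H.map_zero
    rw [h1, h2]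
    simp
  add_mem' := by
    rintro ⟨x, u⟩ ⟨y, v⟩ ⟨hxH, hxA, hx⟩ ⟨hyH, hyA, hy⟩
    refine ⟨H.domain.add_mem hxH hyH, A.domain.add_mem hxA hyA, fun φ hφH hφA => ?_⟩
    have h1 : A ⟨x + y, A.domain.add_mem hxA hyA⟩ = A ⟨x, hxA⟩ + A ⟨y, hyA⟩ :=
      A.map_add ⟨x, hxA⟩ ⟨y, hyA⟩
    have h2 : H ⟨x + y, H.domain.add_mem hxH hyH⟩ = H ⟨x, hxH⟩ + H ⟨y, hyH⟩ :=
      H.map_add ⟨x, hxH⟩ ⟨y, hyH⟩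
    have hx' := hx φ hφH hφA
    have hy' := hy φ hφH hφA
    simp only [Prod.mk_add_mk, h1, h2, inner_add_right] at hx' hy' ⊢
    rw [hx', hy']
    ring
  smul_mem' := by
    rintro c ⟨x, u⟩ ⟨hxH, hxA, hx⟩
    refine ⟨H.domain.smul_mem c hxH, A.domain.smul_mem c hxA, fun φ hφH hφA => ?_⟩
    have h1 : A ⟨c • x, A.domain.smul_mem c hxA⟩ = c • A ⟨x, hxA⟩ := A.map_smul c ⟨x, hxA⟩
    have h2 : H ⟨c • x, H.domain.smul_mem c hxH⟩ = c • H ⟨x, hxH⟩ := H.map_smul c ⟨x, hxH⟩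
    have hx' := hx φ hφH hφA
    simp only [Prod.smul_mk, h1, h2, inner_smul_right] at hx' ⊢
    rw [hx']
    ring

/-- The operator `δ(A) = i[H, A]`, for symmetric `H` and `A`: its domain consists of all `ψ` at
which the form `i[H, A]` is represented by a (unique) vector `δ(A)ψ`. It extends the operator
`i(HA - AH)` on the natural domain of the latter, see `delta_extends`. The iterated commutators
are `(delta H)^[k] A`. -/
noncomputable def delta (H A : E →ₗ.[ℂ] E) : E →ₗ.[ℂ] E :=
  (deltaGraph H A).toLinearPMap

/-- If `dom H ∩ dom A` is dense, the value of the commutator is unique, so that `delta H A` has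
the prescribed graph. -/
theorem delta_graph {H A : E →ₗ.[ℂ] E} (hd : Dense ((H.domain ⊓ A.domain : Submodule ℂ E) : Set E)) :
    (delta H A).graph = deltaGraph H A := by
  apply Submodule.toLinearPMap_graph_eq
  rintro ⟨x, y⟩ ⟨hH, hA, h⟩ hx
  simp only at hx
  subst hx
  refine hd.eq_zero_of_inner_right ℂ fun φ hφ => ?_
  have h0 := h φ hφ.1 hφ.2
  have h1 : A ⟨0, hA⟩ = 0 := A.map_zero
  have h2 : H ⟨0, hH⟩ = 0 := H.map_zero
  simpa [h1, h2] using h0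

/-- For symmetric `H` and `A`, a vector at which `HA` and `AH` are both defined lies in the domain
of `δ(A)`, and there `δ(A) = i(HA - AH)`. -/
theorem delta_extends {H A : E →ₗ.[ℂ] E}
    (hd : Dense ((H.domain ⊓ A.domain : Submodule ℂ E) : Set E))
    (hH : H.IsFormalAdjoint H) (hA : A.IsFormalAdjoint A) (ψ : E)
    (h1 : ψ ∈ H.domain) (h2 : ψ ∈ A.domain)
    (h3 : A ⟨ψ, h2⟩ ∈ H.domain) (h4 : H ⟨ψ, h1⟩ ∈ A.domain) :
    ∃ h : ψ ∈ (delta H A).domain,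
      delta H A ⟨ψ, h⟩ = Complex.I • (H ⟨A ⟨ψ, h2⟩, h3⟩ - A ⟨H ⟨ψ, h1⟩, h4⟩) := by
  have key : (ψ, Complex.I • (H ⟨A ⟨ψ, h2⟩, h3⟩ - A ⟨H ⟨ψ, h1⟩, h4⟩)) ∈ (delta H A).graph := by
    rw [delta_graph hd]
    refine ⟨h1, h2, fun φ hφH hφA => ?_⟩
    have e1 := hH ⟨φ, hφH⟩ ⟨A ⟨ψ, h2⟩, h3⟩
    have e2 := hA ⟨φ, hφA⟩ ⟨H ⟨ψ, h1⟩, h4⟩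
    simp only at e1 e2
    simp only [inner_smul_right, inner_sub_right, e1, e2]
  obtain ⟨z, hz, hz'⟩ := (LinearPMap.mem_graph_iff _).1 key
  simp only at hz hz'
  subst hz
  exact ⟨z.2, hz'⟩

/-- The commutator `δ(A)` of densely defined operators is again symmetric. -/
theorem delta_symm {H A : E →ₗ.[ℂ] E}
    (hd : Dense ((H.domain ⊓ A.domain : Submodule ℂ E) : Set E)) :
    (delta H A).IsFormalAdjoint (delta H A) := by
  intro x y
  have hx : ((x : E), delta H A x) ∈ deltaGraph H A := by
    rw [← delta_graph hd]; exact LinearPMap.mem_graph _ x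
  have hy : ((y : E), delta H A y) ∈ deltaGraph H A := by
    rw [← delta_graph hd]; exact LinearPMap.mem_graph _ y
  obtain ⟨hxH, hxA, h⟩ := hx
  obtain ⟨hyH, hyA, h'⟩ := hy
  rw [h' x hxH hxA, ← inner_conj_symm, h y hyH hyA]
  simp only [map_mul, map_sub, Complex.conj_I, inner_conj_symm]
  ring

/-- `T` is defined on `dom H` and bounded relative to `H + 1`: there is a constant `C` such that
`‖Tψ‖ ≤ C ‖(H + 1)ψ‖` for all `ψ` in `dom H`. -/
def RelBounded (H T : E →ₗ.[ℂ] E) : Prop :=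
  H.domain ≤ T.domain ∧ ∃ C : ℝ, ∀ (ψ : E) (hH : ψ ∈ H.domain) (hT : ψ ∈ T.domain),
    ‖T ⟨ψ, hT⟩‖ ≤ C * ‖H ⟨ψ, hH⟩ + ψ‖

/-- `AB` and `BA` are defined on the subspace `D`, and `AB = BA` there. -/
def CommuteOn (A B : E →ₗ.[ℂ] E) (D : Submodule ℂ E) : Prop :=
  ∀ ψ ∈ D, ∃ (hA : ψ ∈ A.domain) (hB : ψ ∈ B.domain)
    (hAB : B ⟨ψ, hB⟩ ∈ A.domain) (hBA : A ⟨ψ, hA⟩ ∈ B.domain),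
    A ⟨B ⟨ψ, hB⟩, hAB⟩ = B ⟨A ⟨ψ, hA⟩, hBA⟩

variable [CompleteSpace E]

/-- `T` is essentially self-adjoint: it is closable and its closure is self-adjoint. -/
def IsEssentiallySelfAdjoint (T : E →ₗ.[ℂ] E) : Prop :=
  T.IsClosable ∧ IsSelfAdjoint T.closure

/-- `U` is the strongly continuous one-parameter unitary group `U t = exp(itT)`: its generator,
with the domain on which the derivative at `0` exists, is `iT`. -/
structure IsUnitaryGroupOf (T : E →ₗ.[ℂ] E) (U : ℝ → E →L[ℂ] E) : Prop where
  mem_unitary : ∀ t, U t ∈ unitary (E →L[ℂ] E)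
  map_zero : U 0 = 1
  map_add : ∀ s t, U (s + t) = U s * U t
  continuous : ∀ x, Continuous fun t => U t x
  generator : ∀ x y : E, (x, y) ∈ T.graph ↔ HasDerivAt (fun t : ℝ => U t x) (Complex.I • y) 0

/-- The self-adjoint operators `S` and `T` commute strongly: the unitary groups `exp(isS)` and
`exp(itT)` commute. -/
def StronglyCommute (S T : E →ₗ.[ℂ] E) : Prop :=
  ∃ U V : ℝ → E →L[ℂ] E, IsUnitaryGroupOf S U ∧ IsUnitaryGroupOf T V ∧
    ∀ s t, U s * V t = V t * U s

end UnboundedOp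

/-!
The proof works with resolvents only. Put `N = H + 1` and `J n = (1 + N / (n + 1))⁻¹`, bounded
operators that map into `dom H` and converge strongly to `1`. If `p = (χ, η)` is in the graph of the
adjoint of `A` restricted to `dom H`, then the resolvent identity `[A, G] = -i G δ(A) G` for
`G = J n / (n + 1)` shows that `(J n χ, J n η - r n)` is in the graph of `A`, where
`‖r n‖ ≤ C ‖χ - J n χ‖` and `C` is the relative bound of `δ(A)`
(`CommutatorBound.resolvent`, `IsRegularization.commutator`).

Two consequences follow. As `r n → 0`, the pair `p` is a limit of the graph of `A` over `dom H`,
so that the adjoint of this restriction is contained in its closure, which is therefore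
self-adjoint (`CommutatorBound.mem_closure`). A core of `H` may replace `dom H`, by the relative
bound for `A`. Secondly, for `χ = (A - ic)⁻¹ φ` with `φ` in `dom H` and `|c| > C`, the same estimate
bounds `N J n χ = (n + 1) (χ - J n χ)` uniformly in `n`, so that `χ` is in `dom H`
(`CommutatorBound.resolvent_mem_domain`).

If `AB = BA` on `dom H`, then for such `c` the resolvent `K = (A - ic)⁻¹` can be moved past `B` on
`dom H`, hence past the closure of `B` (`CommutatorBound.resolvent_commutesWith`). The unitary
group of a self-adjoint operator is constructed as a strong limit of exponentials of bounded
functions of its resolvents (`exists_isUnitaryGroupOf`); thus it commutes with every bounded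
operator that commutes with the generator. Applied first to the closure of `B` and `K`, then to the
closure of `A` and the unitary group of the closure of `B`, this gives strong commutativity.
-/

namespace UnboundedOp

open Filter Topology

variable {E : Type*} [NormedAddCommGroup E] [InnerProductSpace ℂ E]

/-! ### Self-adjoint operators through their graphs -/

theorem inner_graph_of_symm {T : E →ₗ.[ℂ] E} (hT : T.IsFormalAdjoint T) {p q : E × E}
    (hp : p ∈ T.graph) (hq : q ∈ T.graph) : inner ℂ p.2 q.1 = inner ℂ p.1 q.2 := by
  obtain ⟨x, hx, hx'⟩ := (LinearPMap.mem_graph_iff _).1 hp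
  obtain ⟨y, hy, hy'⟩ := (LinearPMap.mem_graph_iff _).1 hq
  rw [← hx, ← hx', ← hy, ← hy']
  exact hT x y

/-- A family of contractions converges strongly to the identity as soon as it does so on a dense
set. -/
theorem tendsto_of_dense {s : Set E} (hs : Dense s) {J : ℕ → E →L[ℂ] E}
    (hJ : ∀ n x, ‖J n x‖ ≤ ‖x‖) (h : ∀ x ∈ s, Tendsto (fun n => J n x) atTop (𝓝 x)) (x : E) :
    Tendsto (fun n => J n x) atTop (𝓝 x) := by
  rw [Metric.tendsto_atTop]
  intro ε hε
  obtain ⟨y, hy, hxy⟩ := hs.exists_dist_lt x (show 0 < ε / 3 by positivity)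
  obtain ⟨N, hN⟩ := Metric.tendsto_atTop.1 (h y hy) (ε / 3) (by positivity)
  refine ⟨N, fun n hn => ?_⟩
  have h1 := hN n hn
  have h2 : dist (J n x) (J n y) ≤ dist x y := by
    rw [dist_eq_norm, dist_eq_norm, ← map_sub]; exact hJ n _
  have h3 := dist_triangle4 (J n x) (J n y) y x
  rw [dist_comm y x] at h3
  linarith

theorem norm_sub_I_smul_sq {T : E →ₗ.[ℂ] E} (hT : T.IsFormalAdjoint T) {p : E × E}
    (hp : p ∈ T.graph) (c : ℝ) :
    ‖p.2 - (Complex.I * c) • p.1‖ ^ 2 = ‖p.2‖ ^ 2 + (|c| * ‖p.1‖) ^ 2 := by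
  have h := inner_graph_of_symm hT hp hp
  have him : (inner ℂ p.2 p.1).im = 0 := by
    have h2 := inner_conj_symm (𝕜 := ℂ) p.2 p.1
    rw [← h] at h2
    exact Complex.conj_eq_iff_im.1 h2
  rw [@norm_sub_sq ℂ, inner_smul_right, norm_smul]
  simp [him]

/-- The resolvent `(T - ic)⁻¹` of a symmetric operator is bounded by `1 / |c|`. -/
theorem abs_mul_norm_le {T : E →ₗ.[ℂ] E} (hT : T.IsFormalAdjoint T) {p : E × E}
    (hp : p ∈ T.graph) (c : ℝ) : |c| * ‖p.1‖ ≤ ‖p.2 - (Complex.I * c) • p.1‖ := by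
  refine (sq_le_sq₀ (by positivity) (norm_nonneg _)).1 ?_
  rw [norm_sub_I_smul_sq hT hp c]
  nlinarith [sq_nonneg ‖p.2‖]

/-- `K` is the resolvent `(T - z)⁻¹`: a bounded two-sided inverse of `T - z`. -/
structure IsResolvent (T : E →ₗ.[ℂ] E) (z : ℂ) (K : E →L[ℂ] E) : Prop where
  mem_graph : ∀ x, (K x, x + z • K x) ∈ T.graph
  apply_sub : ∀ p ∈ T.graph, K (p.2 - z • p.1) = p.1

/-- `ST ⊆ TS`: the bounded operator `S` commutes with the unbounded operator `T`. -/
def CommutesWith (S : E →L[ℂ] E) (T : E →ₗ.[ℂ] E) : Prop :=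
  ∀ p ∈ T.graph, (S p.1, S p.2) ∈ T.graph

theorem CommutesWith.commute {S K : E →L[ℂ] E} {T : E →ₗ.[ℂ] E} {z : ℂ} (hS : CommutesWith S T)
    (hK : IsResolvent T z K) : Commute S K := by
  ext x
  have h := hK.apply_sub _ (hS _ (hK.mem_graph x))
  simpa [map_add, map_smul] using h.symm

theorem IsResolvent.commutesWith {S K : E →L[ℂ] E} {T : E →ₗ.[ℂ] E} {z : ℂ}
    (hK : IsResolvent T z K) (h : Commute S K) : CommutesWith S T := by
  intro p hp
  have h1 : S p.1 = K (S (p.2 - z • p.1)) := by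
    rw [← hK.apply_sub p hp]
    simpa [hK.apply_sub p hp] using congrArg (fun L : E →L[ℂ] E => L (p.2 - z • p.1)) h.eq
  have h2 := hK.mem_graph (S (p.2 - z • p.1))
  rw [← h1] at h2
  simpa [map_sub, map_smul] using h2

theorem IsResolvent.inner_apply {T : E →ₗ.[ℂ] E} (hT : T.IsFormalAdjoint T) {z w : ℂ}
    (hzw : (starRingEnd ℂ) z = w) {K L : E →L[ℂ] E} (hK : IsResolvent T z K)
    (hL : IsResolvent T w L) (x y : E) : inner ℂ (K x) y = inner ℂ x (L y) := by
  have h := inner_graph_of_symm hT (hK.mem_graph x) (hL.mem_graph y)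
  simp only [inner_add_left, inner_add_right, inner_smul_left, inner_smul_right, hzw] at h
  exact (add_right_cancel h).symm

section Complete

variable [CompleteSpace E]

theorem mem_adjoint_graph_iff {T : E →ₗ.[ℂ] E} (hT : Dense (T.domain : Set E)) (p : E × E) :
    p ∈ T.adjoint.graph ↔ ∀ q ∈ T.graph, inner ℂ q.2 p.1 = inner ℂ q.1 p.2 := by
  rw [LinearPMap.adjoint_graph_eq_graph_adjoint hT, Submodule.mem_adjoint_iff]
  simp only [sub_eq_zero, Prod.forall]

theorem _root_.IsSelfAdjoint.mem_graph_iff {T : E →ₗ.[ℂ] E} (hT : IsSelfAdjoint T) (p : E × E) :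
    p ∈ T.graph ↔ ∀ q ∈ T.graph, inner ℂ q.2 p.1 = inner ℂ q.1 p.2 := by
  conv_lhs => rw [← LinearPMap.isSelfAdjoint_def.1 hT]
  exact mem_adjoint_graph_iff hT.dense_domain p

theorem _root_.IsSelfAdjoint.isFormalAdjoint {T : E →ₗ.[ℂ] E} (hT : IsSelfAdjoint T) :
    T.IsFormalAdjoint T := by
  have h := LinearPMap.adjoint_isFormalAdjoint hT.dense_domain
  rwa [LinearPMap.isSelfAdjoint_def.1 hT] at h

theorem _root_.IsSelfAdjoint.mem_domain_of_bound {T : E →ₗ.[ℂ] E} (hT : IsSelfAdjoint T) {x : E}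
    (M : ℝ) (h : ∀ p ∈ T.graph, ‖(inner ℂ x p.2 : ℂ)‖ ≤ M * ‖p.1‖) : x ∈ T.domain := by
  rw [← LinearPMap.isSelfAdjoint_def.1 hT, LinearPMap.mem_adjoint_domain_iff]
  exact AddMonoidHomClass.continuous_of_bound _ M fun y => h _ (LinearPMap.mem_graph T y)

/-- If `T` is self-adjoint and both `T - z` and `T - z̄` are bounded below, then `z` is in the
resolvent set: the range of `T - z` is closed, and its orthogonal complement is the kernel of
`T - z̄`. -/
theorem _root_.IsSelfAdjoint.exists_resolvent {T : E →ₗ.[ℂ] E} (hT : IsSelfAdjoint T) {z : ℂ}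
    {m : ℝ} (hm : 0 < m) (h1 : ∀ p ∈ T.graph, m * ‖p.1‖ ≤ ‖p.2 - z • p.1‖)
    (h2 : ∀ p ∈ T.graph, m * ‖p.1‖ ≤ ‖p.2 - (starRingEnd ℂ) z • p.1‖) :
    ∃ K : E →L[ℂ] E, IsResolvent T z K ∧ ∀ x, m * ‖K x‖ ≤ ‖x‖ := by
  let f : T.graph →L[ℂ] E :=
    (ContinuousLinearMap.snd ℂ E E - z • ContinuousLinearMap.fst ℂ E E).comp T.graph.subtypeL
  have hf : ∀ p, f p = (p : E × E).2 - z • (p : E × E).1 := fun p => rfl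
  have : CompleteSpace T.graph := hT.isClosed.completeSpace_coe
  have hanti : ∃ c, AntilipschitzWith c f := by
    refine ⟨⟨m⁻¹ + (1 + ‖z‖ * m⁻¹), by positivity⟩,
      AddMonoidHomClass.antilipschitz_of_bound f fun p => ?_⟩
    have e1 : ‖(p : E × E).1‖ ≤ m⁻¹ * ‖f p‖ := by
      rw [le_inv_mul_iff₀ hm]; exact h1 p p.2
    have e2 : ‖(p : E × E).2‖ ≤ (1 + ‖z‖ * m⁻¹) * ‖f p‖ := by
      have : (p : E × E).2 = f p + z • (p : E × E).1 := by rw [hf]; abel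
      calc ‖(p : E × E).2‖ ≤ ‖f p‖ + ‖z • (p : E × E).1‖ := by
            conv_lhs => rw [this]
            exact norm_add_le _ _
        _ ≤ ‖f p‖ + ‖z‖ * (m⁻¹ * ‖f p‖) := by rw [norm_smul]; gcongr
        _ = _ := by ring
    have e3 : 0 ≤ m⁻¹ * ‖f p‖ := by positivity
    have e4 : 0 ≤ (1 + ‖z‖ * m⁻¹) * ‖f p‖ := by positivity
    change max ‖(p : E × E).1‖ ‖(p : E × E).2‖ ≤ (m⁻¹ + (1 + ‖z‖ * m⁻¹)) * ‖f p‖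
    rw [add_mul]
    exact max_le (by linarith) (by linarith)
  obtain ⟨c, hc⟩ := hanti
  have hinj : Function.Injective f := hc.injective
  have hcl : IsClosed (Set.range f) := hc.isClosed_range f.uniformContinuous
  have hsurj : Function.Surjective f := by
    have hcl' : IsClosed (f.toLinearMap.range : Set E) := hcl
    have : CompleteSpace f.toLinearMap.range := hcl'.completeSpace_coe
    suffices h : f.toLinearMap.range = ⊤ from LinearMap.range_eq_top.1 h
    rw [← Submodule.orthogonal_eq_bot_iff, Submodule.eq_bot_iff]
    intro w hw
    have hmem : (w, (starRingEnd ℂ) z • w) ∈ T.graph := by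
      rw [hT.mem_graph_iff]
      intro q hq
      have h := (Submodule.mem_orthogonal _ _).1 hw (f ⟨q, hq⟩) ⟨⟨q, hq⟩, rfl⟩
      rw [hf, inner_sub_left, inner_smul_left, sub_eq_zero] at h
      rw [inner_smul_right]
      exact h
    have h := h2 _ hmem
    simp only [sub_self, norm_zero] at h
    exact norm_le_zero_iff.1 (nonpos_of_mul_nonpos_right h hm)
  let e := LinearEquiv.ofBijective (f : T.graph →ₗ[ℂ] E) ⟨hinj, hsurj⟩
  have he : ∀ x, f (e.symm x) = x := fun x => e.apply_symm_apply x
  have hb : ∀ x, ‖((e.symm x : T.graph) : E × E).1‖ ≤ m⁻¹ * ‖x‖ := fun x => by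
    rw [le_inv_mul_iff₀ hm]
    have h := h1 _ (e.symm x).2
    rwa [← hf, he] at h
  refine ⟨LinearMap.mkContinuous
    ((LinearMap.fst ℂ E E).comp (T.graph.subtype.comp e.symm.toLinearMap)) m⁻¹ hb,
    ⟨fun x => ?_, fun p hp => ?_⟩, fun x => ?_⟩
  · have h := (e.symm x).2
    convert h using 1
    refine Prod.ext rfl ?_
    change x + z • ((e.symm x : T.graph) : E × E).1 = _
    conv_lhs => enter [1]; rw [← he x, hf]
    abel
  · change ((e.symm (f ⟨p, hp⟩) : T.graph) : E × E).1 = p.1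
    have : e.symm (f ⟨p, hp⟩) = ⟨p, hp⟩ := e.symm_apply_apply _
    rw [this]
  · rw [← le_inv_mul_iff₀ hm]
    exact hb x

theorem _root_.IsSelfAdjoint.exists_resolvent_I {T : E →ₗ.[ℂ] E} (hT : IsSelfAdjoint T) {c : ℝ}
    (hc : c ≠ 0) :
    ∃ K : E →L[ℂ] E, IsResolvent T (Complex.I * c) K ∧ ∀ x, |c| * ‖K x‖ ≤ ‖x‖ := by
  refine hT.exists_resolvent (abs_pos.2 hc)
    (fun p hp => abs_mul_norm_le hT.isFormalAdjoint hp c) fun p hp => ?_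
  have h := abs_mul_norm_le hT.isFormalAdjoint hp (-c)
  simpa using h

/-- A symmetric operator is essentially self-adjoint if its adjoint is contained in its closure. -/
theorem isEssentiallySelfAdjoint_of_adjoint_le {T : E →ₗ.[ℂ] E} (hd : Dense (T.domain : Set E))
    (hT : T.IsFormalAdjoint T)
    (h : ∀ p : E × E, (∀ q ∈ T.graph, inner ℂ q.2 p.1 = inner ℂ q.1 p.2) →
      p ∈ closure (T.graph : Set (E × E))) : IsEssentiallySelfAdjoint T := by
  have hcl : T.IsClosable :=
    LinearPMap.isClosable_iff_exists_closed_extension.2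
      ⟨_, LinearPMap.adjoint_isClosed hd, LinearPMap.IsFormalAdjoint.le_adjoint hd hT⟩
  have hg : (T.closure.graph : Set (E × E)) = closure (T.graph : Set (E × E)) := by
    rw [← hcl.graph_closure_eq_closure_graph, Submodule.topologicalClosure_coe]
  have hd' : Dense (T.closure.domain : Set E) := hd.mono T.le_closure.1
  refine ⟨hcl, LinearPMap.isSelfAdjoint_def.2 (LinearPMap.eq_of_eq_graph ?_)⟩
  ext p
  rw [mem_adjoint_graph_iff hd', ← SetLike.mem_coe (p := T.closure.graph), hg]
  constructor
  · exact fun hp => h p fun q hq => hp q (LinearPMap.le_graph_of_le T.le_closure hq)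
  · intro hp q hq
    rw [← SetLike.mem_coe, hg] at hq
    -- the closure of a symmetric graph is symmetric, by continuity in each argument
    refine closure_minimal (s := (T.graph : Set (E × E)))
      (t := {q | inner ℂ q.2 p.1 = inner ℂ q.1 p.2}) (fun q hq => ?_)
      (isClosed_eq (by fun_prop) (by fun_prop)) hq
    exact closure_minimal (s := (T.graph : Set (E × E)))
      (t := {p | inner ℂ q.2 p.1 = inner ℂ q.1 p.2})
      (fun p hp => inner_graph_of_symm hT hq hp)
      (isClosed_eq (by fun_prop) (by fun_prop)) hp

end Complete

section

variable [CompleteSpace E]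

/-! ### Unitary groups of bounded operators -/

/-- `exp(itS)` for a bounded operator `S`. -/
noncomputable def expI (S : E →L[ℂ] E) (t : ℝ) : E →L[ℂ] E :=
  NormedSpace.exp (t • (Complex.I • S))

theorem expI_zero (S : E →L[ℂ] E) : expI S 0 = 1 := by
  simp [expI]

theorem expI_add (S : E →L[ℂ] E) (s t : ℝ) : expI S (s + t) = expI S s * expI S t := by
  let +nondep : NormedAlgebra ℚ (E →L[ℂ] E) := .restrictScalars ℚ ℂ (E →L[ℂ] E)
  rw [expI, add_smul]
  exact NormedSpace.exp_add_of_commute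
    (((Commute.refl (Complex.I • S)).smul_left s).smul_right t)

theorem expI_add_left {S T : E →L[ℂ] E} (h : Commute S T) (t : ℝ) :
    expI (S + T) t = expI S t * expI T t := by
  let +nondep : NormedAlgebra ℚ (E →L[ℂ] E) := .restrictScalars ℚ ℂ (E →L[ℂ] E)
  rw [expI, smul_add, smul_add]
  exact NormedSpace.exp_add_of_commute
    ((((h.smul_left Complex.I).smul_right Complex.I).smul_left t).smul_right t)

theorem commute_expI {S T : E →L[ℂ] E} (h : Commute S T) (t : ℝ) : Commute S (expI T t) :=
  ((h.smul_right Complex.I).smul_right t).exp_right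

theorem hasDerivAt_expI (S : E →L[ℂ] E) (x : E) (t : ℝ) :
    HasDerivAt (fun s => expI S s x) (expI S t (Complex.I • S x)) t := by
  have h := hasDerivAt_exp_smul_const (𝕂 := ℝ) (Complex.I • S) t
  exact ((ContinuousLinearMap.apply ℂ E x).restrictScalars ℝ).hasFDerivAt.comp_hasDerivAt t h

theorem norm_expI_apply {S : E →L[ℂ] E} (hS : IsSelfAdjoint S) (t : ℝ) (x : E) :
    ‖expI S t x‖ = ‖x‖ := by
  have h1 : t • (Complex.I • S) ∈ skewAdjoint (E →L[ℂ] E) := by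
    rw [skewAdjoint.mem_iff, star_smul, star_smul, hS.star_eq]
    simp
  let +nondep : NormedAlgebra ℚ (E →L[ℂ] E) := .restrictScalars ℚ ℂ (E →L[ℂ] E)
  have h2 := NormedSpace.exp_mem_unitary_of_mem_skewAdjoint h1
  exact ContinuousLinearMap.norm_map_of_mem_unitary h2 x

theorem norm_expI_sub_le {S : E →L[ℂ] E} (hS : IsSelfAdjoint S) (t : ℝ) (x : E) :
    ‖expI S t x - x‖ ≤ |t| * ‖S x‖ := by
  have h := (convex_uIcc (0 : ℝ) t).norm_image_sub_le_of_norm_hasDerivWithin_le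
    (f := fun s => expI S s x) (C := ‖S x‖)
    (fun s _ => (hasDerivAt_expI S x s).hasDerivWithinAt)
    (fun s _ => by rw [norm_expI_apply hS, norm_smul, Complex.norm_I, one_mul])
    Set.left_mem_uIcc Set.right_mem_uIcc
  simpa [expI_zero, mul_comm] using h

/-- First-order expansion of `exp(itS)`, with `y` in place of `Sx` and an auxiliary vector `w`
close to `y`. -/
theorem norm_expI_sub_sub_le {S : E →L[ℂ] E} (hS : IsSelfAdjoint S) (t : ℝ) (x y w : E) :
    ‖expI S t x - x - t • (Complex.I • y)‖ ≤
      |t| * (‖S x - y‖ + (2 * ‖y - w‖ + |t| * ‖S w‖)) := by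
  have h := (convex_uIcc (0 : ℝ) t).norm_image_sub_le_of_norm_hasDerivWithin_le
    (f := fun s => expI S s x - s • (Complex.I • y))
    (f' := fun s => expI S s (Complex.I • S x) - (1 : ℝ) • (Complex.I • y))
    (C := ‖S x - y‖ + (2 * ‖y - w‖ + |t| * ‖S w‖))
    (fun s _ => ((hasDerivAt_expI S x s).sub
      ((hasDerivAt_id s).smul_const (Complex.I • y))).hasDerivWithinAt)
    (fun s hs => ?_) Set.left_mem_uIcc Set.right_mem_uIcc
  · simp only [expI_zero, zero_smul, sub_zero, one_apply_eq_self,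
      Real.norm_eq_abs] at h
    rw [mul_comm, sub_right_comm]
    exact h
  · have hst : |s| ≤ |t| := by simpa using Set.abs_sub_left_of_mem_uIcc hs
    have e : expI S s (Complex.I • S x) - (1 : ℝ) • (Complex.I • y) =
        Complex.I • (expI S s (S x - y) + (expI S s (y - w) + (expI S s w - w) - (y - w))) := by
      simp only [map_smul, map_sub, one_smul, smul_add, smul_sub]
      abel
    rw [e, norm_smul, Complex.norm_I, one_mul]
    refine (norm_add_le _ _).trans (add_le_add (norm_expI_apply hS _ _).le ?_)
    refine (norm_sub_le _ _).trans ?_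
    have h1 := norm_add_le (expI S s (y - w)) (expI S s w - w)
    have h2 := norm_expI_sub_le hS s w
    rw [norm_expI_apply hS] at h1
    have h3 : |s| * ‖S w‖ ≤ |t| * ‖S w‖ := by gcongr
    linarith

theorem norm_expI_sub_expI_le {S T : E →L[ℂ] E} (hS : IsSelfAdjoint S) (hT : IsSelfAdjoint T)
    (h : Commute S T) (t : ℝ) (x : E) :
    ‖expI S t x - expI T t x‖ ≤ |t| * ‖S x - T x‖ := by
  have e : expI S t = expI T t * expI (S - T) t := by
    rw [← expI_add_left (h.symm.sub_right (Commute.refl T)), add_sub_cancel]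
  rw [e, mul_apply_eq_comp, ← map_sub, norm_expI_apply hT]
  exact norm_expI_sub_le (hS.sub hT) t x

/-! ### Stone's theorem: existence of the unitary group -/

theorem tendsto_inv_succ_mul (a : ℝ) :
    Tendsto (fun n : ℕ => ((n : ℝ) + 1)⁻¹ * a) atTop (𝓝 0) := by
  have h := (tendsto_one_div_add_atTop_nhds_zero_nat (𝕜 := ℝ)).mul_const a
  simpa using h

/-- For self-adjoint `T` and `|c| → ∞`, the operators `-ic (T - ic)⁻¹` converge strongly to `1`. -/
theorem tendsto_smul_resolvent {T : E →ₗ.[ℂ] E} (hT : IsSelfAdjoint T) {c : ℕ → ℝ}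
    (hc : ∀ n, |c n| = n + 1) {K : ℕ → E →L[ℂ] E}
    (hK : ∀ n, IsResolvent T (Complex.I * c n) (K n)) (hb : ∀ n x, |c n| * ‖K n x‖ ≤ ‖x‖) (x : E) :
    Tendsto (fun n => -(Complex.I * c n) • K n x) atTop (𝓝 x) := by
  have hn : ∀ n y, ‖-(Complex.I * (c n : ℂ)) • K n y‖ = |c n| * ‖K n y‖ := fun n y => by
    rw [norm_smul]; simp
  refine tendsto_of_dense hT.dense_domain (J := fun n => (-(Complex.I * (c n : ℂ))) • K n)
    (fun n y => ?_) (fun y hy => ?_) x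
  · rw [smul_apply, hn]; exact hb n y
  · obtain ⟨z, hz⟩ := LinearPMap.mem_domain_iff.1 hy
    refine tendsto_iff_norm_sub_tendsto_zero.2 (squeeze_zero (fun _ => norm_nonneg _)
      (fun n => ?_) (tendsto_inv_succ_mul ‖z‖))
    have e : -(Complex.I * (c n : ℂ)) • K n y - y = - K n z := by
      have h := (hK n).apply_sub _ hz
      simp only [map_sub, map_smul] at h
      rw [neg_smul]
      nth_rewrite 2 [← h]
      abel
    rw [smul_apply, e, norm_neg, le_inv_mul_iff₀ (by positivity), ← hc]
    exact hb n z

/-- The Yosida approximation: a self-adjoint operator `T` is the strong limit, on its domain, of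
bounded self-adjoint operators which lie in the bicommutant of `T`, namely of
`c²/2 ((T - ic)⁻¹ + (T + ic)⁻¹)` for `c → ∞`. -/
theorem exists_approx {T : E →ₗ.[ℂ] E} (hT : IsSelfAdjoint T) :
    ∃ S : ℕ → E →L[ℂ] E, (∀ n, IsSelfAdjoint (S n)) ∧
      (∀ n R, CommutesWith R T → Commute R (S n)) ∧ (∀ n, CommutesWith (S n) T) ∧
      ∀ p ∈ T.graph, Tendsto (fun n => S n p.1) atTop (𝓝 p.2) := by
  have hc : ∀ n : ℕ, ((n : ℝ) + 1) ≠ 0 := fun n => by positivity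
  have hc' : ∀ n : ℕ, -((n : ℝ) + 1) ≠ 0 := fun n => neg_ne_zero.2 (hc n)
  have ha : ∀ n : ℕ, |(n : ℝ) + 1| = n + 1 := fun n => abs_of_nonneg (by positivity)
  choose K hK hKb using fun n : ℕ => hT.exists_resolvent_I (hc n)
  choose L hL hLb using fun n : ℕ => hT.exists_resolvent_I (hc' n)
  have hKL : ∀ n x y, inner ℂ (K n x) y = inner ℂ x (L n y) := fun n x y =>
    IsResolvent.inner_apply hT.isFormalAdjoint (by simp; ring) (hK n) (hL n) x y
  have hLK : ∀ n x y, inner ℂ (L n x) y = inner ℂ x (K n y) := fun n x y =>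
    IsResolvent.inner_apply hT.isFormalAdjoint (by simp; ring) (hL n) (hK n) x y
  have hcomm : ∀ (n : ℕ) R, CommutesWith R T →
      Commute R ((((n : ℝ) + 1) ^ 2 / 2) • (K n + L n)) := fun n R hR =>
    ((hR.commute (hK n)).add_right (hR.commute (hL n))).smul_right _
  refine ⟨fun n => (((n : ℝ) + 1) ^ 2 / 2) • (K n + L n), fun n => ?_, hcomm, fun n => ?_, ?_⟩
  · refine IsSelfAdjoint.smul (IsSelfAdjoint.all _) ?_
    rw [ContinuousLinearMap.isSelfAdjoint_iff_isSymmetric]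
    intro x y
    simp [inner_add_left, inner_add_right, hKL, hLK, add_comm]
  · have h1 := (hcomm n _ ((hK n).commutesWith (Commute.refl (K n)))).symm
    exact (hK n).commutesWith h1
  · intro p hp
    have t1 := tendsto_smul_resolvent hT ha hK hKb p.2
    have t2 := tendsto_smul_resolvent hT (fun n => by rw [abs_neg, ha n]) hL hLb p.2
    have t := (t1.add t2).const_smul (1 / 2 : ℂ)
    rw [← two_smul ℂ p.2, smul_smul, show (1 / 2 : ℂ) * 2 = 1 by norm_num, one_smul] at t
    refine t.congr fun n => ?_
    have h1 := (hK n).apply_sub _ hp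
    have h2 := (hL n).apply_sub _ hp
    rw [map_sub, map_smul, sub_eq_iff_eq_add] at h1 h2
    rw [h1, h2, smul_apply, add_apply,
      ← Complex.coe_smul]
    push_cast
    match_scalars <;> ring_nf <;> simp <;> ring

/-- The groups `exp(itS n)` of the Yosida approximations converge strongly. -/
theorem exists_tendsto_expI {T : E →ₗ.[ℂ] E} (hd : Dense (T.domain : Set E))
    {S : ℕ → E →L[ℂ] E} (hS : ∀ n, IsSelfAdjoint (S n)) (hSS : ∀ m n, Commute (S m) (S n))
    (hST : ∀ p ∈ T.graph, Tendsto (fun n => S n p.1) atTop (𝓝 p.2)) (t : ℝ) :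
    ∃ U : E →L[ℂ] E, ∀ x, Tendsto (fun n => expI (S n) t x) atTop (𝓝 (U x)) := by
  have hcauchy : ∀ x, CauchySeq fun n => expI (S n) t x := by
    intro x
    rw [Metric.cauchySeq_iff']
    intro ε hε
    obtain ⟨y, hy, hxy⟩ := hd.exists_dist_lt x (show 0 < ε / 3 by positivity)
    obtain ⟨z, hz⟩ := LinearPMap.mem_domain_iff.1 hy
    obtain ⟨N, hN⟩ := Metric.cauchySeq_iff'.1 (hST _ hz).cauchySeq (ε / 3 / (|t| + 1))
      (by positivity)
    refine ⟨N, fun n hn => ?_⟩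
    have h1 : dist (expI (S n) t y) (expI (S N) t y) < ε / 3 := by
      rw [dist_eq_norm]
      refine (norm_expI_sub_expI_le (hS n) (hS N) (hSS n N) t y).trans_lt ?_
      have h := hN n hn
      rw [dist_eq_norm, lt_div_iff₀ (by positivity)] at h
      nlinarith [norm_nonneg (S n y - S N y)]
    have h2 : ∀ k, dist (expI (S k) t x) (expI (S k) t y) = dist x y := fun k => by
      rw [dist_eq_norm, ← map_sub, norm_expI_apply (hS k), dist_eq_norm]
    have h3 := dist_triangle4 (expI (S n) t x) (expI (S n) t y) (expI (S N) t y)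
      (expI (S N) t x)
    rw [h2, dist_comm (expI (S N) t y), h2] at h3
    linarith
  choose f hf using fun x => cauchySeq_tendsto_of_complete (hcauchy x)
  exact ⟨continuousLinearMapOfTendsto _ (tendsto_pi_nhds.2 hf), hf⟩

/-- **Stone's theorem**: a self-adjoint operator generates a strongly continuous one-parameter
unitary group. Since the group is a strong limit of functions of the resolvents, it commutes with
every bounded operator that commutes with `T`. -/
theorem exists_isUnitaryGroupOf {T : E →ₗ.[ℂ] E} (hT : IsSelfAdjoint T) :
    ∃ U : ℝ → E →L[ℂ] E, IsUnitaryGroupOf T U ∧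
      ∀ R, CommutesWith R T → ∀ t, Commute R (U t) := by
  obtain ⟨S, hS, hcomm, hself, hST⟩ := exists_approx hT
  have hd := hT.dense_domain
  have hSS : ∀ m n, Commute (S m) (S n) := fun m n => hcomm n _ (hself m)
  choose U hU using exists_tendsto_expI hd hS hSS hST
  have hnorm : ∀ t x, ‖U t x‖ = ‖x‖ := fun t x =>
    tendsto_nhds_unique (hU t x).norm (by simp only [norm_expI_apply (hS _), tendsto_const_nhds])
  have hzero : U 0 = 1 := by
    ext x
    exact tendsto_nhds_unique (hU 0 x) (by simp only [expI_zero]; exact tendsto_const_nhds)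
  have hadd : ∀ s t, U (s + t) = U s * U t := by
    intro s t
    ext x
    refine tendsto_nhds_unique (hU (s + t) x) ?_
    have h1 : Tendsto (fun n => expI (S n) s (expI (S n) t x - U t x)) atTop (𝓝 0) := by
      rw [tendsto_zero_iff_norm_tendsto_zero]
      simp only [norm_expI_apply (hS _)]
      exact tendsto_iff_norm_sub_tendsto_zero.1 (hU t x)
    have h2 := h1.add (hU s (U t x))
    rw [zero_add] at h2
    refine h2.congr fun n => ?_
    rw [map_sub, sub_add_cancel, expI_add, mul_apply_eq_comp]
  have hinv : ∀ t x, U t (U (-t) x) = x := fun t x => by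
    rw [← mul_apply_eq_comp, ← hadd, add_neg_cancel, hzero, one_apply_eq_self]
  have hinner : ∀ t x y, inner ℂ (U t x) (U t y) = inner ℂ x y := fun t =>
    (LinearMap.norm_map_iff_inner_map_map (U t)).1 (hnorm t)
  have hadj : ∀ t x y, inner ℂ (U t x) y = inner ℂ x (U (-t) y) := fun t x y => by
    rw [← hinner t x, hinv]
  have hstar : ∀ t, star (U t) = U (-t) := fun t => by
    rw [ContinuousLinearMap.star_eq_adjoint, eq_comm, ContinuousLinearMap.eq_adjoint_iff]
    intro x y
    rw [hadj, neg_neg]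
  -- bounds on the domain of `T`, inherited from the approximations
  have hbound : ∀ t, ∀ p ∈ T.graph, ‖U t p.1 - p.1‖ ≤ |t| * ‖p.2‖ := fun t p hp =>
    le_of_tendsto_of_tendsto' ((hU t p.1).sub_const p.1).norm ((hST p hp).norm.const_mul |t|)
      fun n => norm_expI_sub_le (hS n) t p.1
  have hbound2 : ∀ t, ∀ p ∈ T.graph, ∀ q ∈ T.graph,
      ‖U t p.1 - p.1 - t • (Complex.I • p.2)‖ ≤ |t| * (2 * ‖p.2 - q.1‖ + |t| * ‖q.2‖) := by
    intro t p hp q hq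
    have h1 : Tendsto (fun n => ‖S n p.1 - p.2‖) atTop (𝓝 0) :=
      tendsto_iff_norm_sub_tendsto_zero.1 (hST p hp)
    have h2 := ((h1.add (((hST q hq).norm.const_mul |t|).const_add
      (2 * ‖p.2 - q.1‖))).const_mul |t|)
    rw [zero_add] at h2
    exact le_of_tendsto_of_tendsto' (((hU t p.1).sub_const p.1).sub_const _).norm h2
      fun n => norm_expI_sub_sub_le (hS n) t p.1 p.2 q.1
  have hcont0 : ∀ x, Tendsto (fun t => ‖U t x - x‖) (𝓝 0) (𝓝 0) := by
    intro x
    rw [Metric.tendsto_nhds]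
    intro ε hε
    obtain ⟨y, hy, hxy⟩ := hd.exists_dist_lt x (show 0 < ε / 4 by positivity)
    obtain ⟨z, hz⟩ := LinearPMap.mem_domain_iff.1 hy
    have h0 : Tendsto (fun t : ℝ => |t| * ‖z‖) (𝓝 0) (𝓝 0) := by
      have : Continuous fun t : ℝ => |t| * ‖z‖ := by fun_prop
      simpa using this.tendsto 0
    filter_upwards [h0.eventually_lt_const (show 0 < ε / 4 by positivity)] with t ht
    have h1 := hbound t _ hz
    have h2 : U t x - x = U t (x - y) + (U t y - y) - (x - y) := by rw [map_sub]; abel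
    have h3 : ‖U t x - x‖ ≤ ‖x - y‖ + ‖U t y - y‖ + ‖x - y‖ := by
      rw [h2]
      refine (norm_sub_le _ _).trans (add_le_add ((norm_add_le _ _).trans ?_) le_rfl)
      rw [hnorm]
    rw [dist_eq_norm] at hxy
    rw [Real.dist_eq, sub_zero, abs_of_nonneg (norm_nonneg _)]
    simp only at h1
    linarith
  have hderiv : ∀ p ∈ T.graph, HasDerivAt (fun t : ℝ => U t p.1) (Complex.I • p.2) 0 := by
    intro p hp
    rw [hasDerivAt_iff_isLittleO, Asymptotics.isLittleO_iff]
    intro ε hε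
    obtain ⟨y, hy, hxy⟩ := hd.exists_dist_lt p.2 (show 0 < ε / 4 by positivity)
    obtain ⟨z, hz⟩ := LinearPMap.mem_domain_iff.1 hy
    have h0 : Tendsto (fun t : ℝ => |t| * ‖z‖) (𝓝 0) (𝓝 0) := by
      have : Continuous fun t : ℝ => |t| * ‖z‖ := by fun_prop
      simpa using this.tendsto 0
    filter_upwards [h0.eventually_lt_const (show 0 < ε / 4 by positivity)] with t ht
    have h1 := hbound2 t p hp _ hz
    rw [dist_eq_norm] at hxy
    rw [hzero, sub_zero, one_apply_eq_self, Real.norm_eq_abs, mul_comm ε]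
    refine h1.trans (mul_le_mul_of_nonneg_left ?_ (abs_nonneg t))
    simp only
    linarith
  refine ⟨U, ⟨fun t => ?_, hzero, hadd, fun x => ?_, fun x y => ⟨hderiv (x, y), fun h => ?_⟩⟩,
    fun R hR t => ?_⟩
  · rw [Unitary.mem_iff, hstar, ← hadd, ← hadd, neg_add_cancel, add_neg_cancel, hzero]
    exact ⟨rfl, rfl⟩
  · rw [continuous_iff_continuousAt]
    intro s
    refine tendsto_iff_norm_sub_tendsto_zero.2 ?_
    have h1 : Tendsto (fun t : ℝ => t - s) (𝓝 s) (𝓝 0) := by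
      have : Continuous fun t : ℝ => t - s := by fun_prop
      simpa using this.tendsto s
    refine ((hcont0 x).comp h1).congr fun t => ?_
    have e : U t x = U s (U (t - s) x) := by
      rw [← mul_apply_eq_comp, ← hadd, add_sub_cancel]
    rw [e, ← map_sub, hnorm]
    rfl
  · -- compare the derivatives at `0` of `⟪q, U t x⟫ = ⟪U (-t) q, x⟫`
    rw [hT.mem_graph_iff]
    intro q hq
    have d1 : HasDerivAt (fun t : ℝ => inner ℂ q.1 (U t x)) (inner ℂ q.1 (Complex.I • y)) 0 := by
      have h1 := (hasDerivAt_const (0 : ℝ) q.1).inner ℂ h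
      rwa [inner_zero_left, add_zero] at h1
    have d2 : HasDerivAt (fun t : ℝ => U (-t) q.1) (-(Complex.I • q.2)) 0 := by
      have h := hderiv q hq
      rw [← neg_zero] at h
      simpa [Function.comp_def] using h.scomp (0 : ℝ) (hasDerivAt_neg (0 : ℝ))
    have d3 : HasDerivAt (fun t : ℝ => inner ℂ (U (-t) q.1) x)
        (inner ℂ (-(Complex.I • q.2)) x) 0 := by
      simpa using d2.inner ℂ (hasDerivAt_const (0 : ℝ) x)
    have e : (fun t : ℝ => inner ℂ q.1 (U t x)) = fun t : ℝ => inner ℂ (U (-t) q.1) x := by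
      funext t
      rw [hadj, neg_neg]
    rw [e] at d1
    have h2 := d3.unique d1
    simp only [inner_neg_left, inner_smul_left, inner_smul_right, Complex.conj_I, neg_mul,
      neg_neg] at h2
    exact mul_left_cancel₀ Complex.I_ne_zero h2
  · ext x
    refine tendsto_nhds_unique (((R.continuous.tendsto _).comp (hU t x)).congr fun n => ?_)
      (hU t (R x))
    exact congrArg (fun L : E →L[ℂ] E => L x) (commute_expI (hcomm n R hR) t).eq

end

/-! ### First-order commutator bounds -/

/-- `A` is symmetric and bounded relative to `H + 1`, and so is the commutator `i[H, A]`, with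
relative bound `C`. -/
structure CommutatorBound (H A : E →ₗ.[ℂ] E) (C : ℝ) : Prop where
  symm : A.IsFormalAdjoint A
  le_domain : H.domain ≤ A.domain
  bound : ∃ M : ℝ, ∀ p ∈ H.graph, ∀ a, (p.1, a) ∈ A.graph → ‖a‖ ≤ M * ‖p.2 + p.1‖
  commutator : ∀ p ∈ H.graph, ∀ a, (p.1, a) ∈ A.graph → ∃ d, ‖d‖ ≤ C * ‖p.2 + p.1‖ ∧
    ∀ q ∈ H.graph, ∀ b, (q.1, b) ∈ A.graph →
      inner ℂ q.1 d = Complex.I * (inner ℂ q.2 a - inner ℂ b p.2)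

theorem exists_apply_of_mem_graph {T : E →ₗ.[ℂ] E} {x y : E} (h : (x, y) ∈ T.graph) :
    ∃ hx : x ∈ T.domain, T ⟨x, hx⟩ = y := by
  obtain ⟨z, hz, hz'⟩ := (LinearPMap.mem_graph_iff _).1 h
  obtain rfl : (z : E) = x := hz
  exact ⟨z.2, hz'⟩

theorem CommutatorBound.of_relBounded {H A : E →ₗ.[ℂ] E} (hd : Dense (H.domain : Set E))
    (hA : A.IsFormalAdjoint A) (h0 : RelBounded H A) (h1 : RelBounded H (delta H A)) :
    ∃ C, CommutatorBound H A C := by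
  obtain ⟨hdom, M, hM⟩ := h0
  obtain ⟨hdom', C, hC⟩ := h1
  have hinf : H.domain ⊓ A.domain = H.domain := inf_eq_left.2 hdom
  refine ⟨C, hA, hdom, ⟨M, ?_⟩, ?_⟩
  · rintro ⟨x, y⟩ hp a ha
    obtain ⟨hx, rfl⟩ := exists_apply_of_mem_graph hp
    obtain ⟨hx', rfl⟩ := exists_apply_of_mem_graph ha
    exact hM x hx hx'
  · rintro ⟨x, y⟩ hp a ha
    obtain ⟨hx, rfl⟩ := exists_apply_of_mem_graph hp
    obtain ⟨hx', rfl⟩ := exists_apply_of_mem_graph ha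
    refine ⟨delta H A ⟨x, hdom' hx⟩, hC x hx (hdom' hx), ?_⟩
    rintro ⟨u, v⟩ hq b hb
    obtain ⟨hu, rfl⟩ := exists_apply_of_mem_graph hq
    obtain ⟨hu', rfl⟩ := exists_apply_of_mem_graph hb
    have hg : (x, delta H A ⟨x, hdom' hx⟩) ∈ deltaGraph H A := by
      rw [← delta_graph (by rw [hinf]; exact hd)]
      exact LinearPMap.mem_graph _ ⟨x, hdom' hx⟩
    obtain ⟨_, _, h⟩ := hg
    exact h u hu hu'

/-- The commutator of `A` with a resolvent `G` of `H` is `[A, G] = -i G δ(A) G`. It suffices that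
the pair `p` belongs to the graph of the adjoint of the restriction of `A` to `dom H`. -/
theorem CommutatorBound.resolvent {H A : E →ₗ.[ℂ] E} {C c : ℝ} (hA : CommutatorBound H A C)
    (hH : H.IsFormalAdjoint H) {G : E →L[ℂ] E} (hG : IsResolvent H (c : ℂ) G)
    {m : ℝ} (hb : ∀ x, m * ‖G x‖ ≤ ‖x‖) {p : E × E}
    (hp : ∀ q ∈ A.graph, q.1 ∈ H.domain → inner ℂ q.2 p.1 = inner ℂ q.1 p.2) :
    ∃ r, (G p.1, G p.2 - r) ∈ A.graph ∧
      m * ‖r‖ ≤ C * ‖p.1 + (c : ℂ) • G p.1 + G p.1‖ := by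
  have hGA : ∀ x, ∃ a, (G x, a) ∈ A.graph := fun x => LinearPMap.mem_domain_iff.1
    (hA.le_domain (LinearPMap.mem_domain_of_mem_graph (hG.mem_graph x)))
  have hGs : ∀ x y, inner ℂ (G x) y = inner ℂ x (G y) := fun x y =>
    hG.inner_apply hH (Complex.conj_ofReal c) hG x y
  obtain ⟨a, ha⟩ := hGA p.1
  obtain ⟨d, hd, hd'⟩ := hA.commutator _ (hG.mem_graph p.1) a ha
  refine ⟨Complex.I • G d, ?_, ?_⟩
  · suffices e : G p.2 - Complex.I • G d = a by rw [e]; exact ha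
    refine ext_inner_left ℂ fun x => ?_
    obtain ⟨b, hb⟩ := hGA x
    have h1 := hd' _ (hG.mem_graph x) b hb
    have h2 := hp _ hb (LinearPMap.mem_domain_of_mem_graph (hG.mem_graph x))
    have h3 := inner_graph_of_symm hA.symm hb ha
    simp only [inner_add_left, inner_add_right, inner_smul_left, inner_smul_right,
      Complex.conj_ofReal] at h1 h2 h3
    rw [inner_sub_right, inner_smul_right, ← hGs, ← hGs, h1, ← h2, h3]
    linear_combination (inner ℂ b p.1 - inner ℂ x a) * Complex.I_mul_I
  · rw [norm_smul, Complex.norm_I, one_mul]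
    exact (hb d).trans (by simpa using hd)

/-! ### Regularization by the resolvents of a positive operator -/

/-- `J n` plays the role of `(1 + N / (n + 1))⁻¹`, where `N = H + 1`: these operators converge
strongly to `1`, they map into `dom H` with `N J n x = (n + 1) (x - J n x)`, and their commutators
with operators satisfying a commutator bound vanish in the limit. -/
structure IsRegularization (H : E →ₗ.[ℂ] E) (J : ℕ → E →L[ℂ] E) : Prop where
  tendsto : ∀ x, Tendsto (fun n => J n x) atTop (𝓝 x)
  norm_sub_le : ∀ n : ℕ, ∀ p ∈ H.graph, ((n : ℝ) + 1) * ‖p.1 - J n p.1‖ ≤ ‖p.2 + p.1‖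
  mem_graph : ∀ (n : ℕ) x, (J n x, ((n : ℝ) + 1) • (x - J n x) - J n x) ∈ H.graph
  commutator : ∀ (n : ℕ) (A : E →ₗ.[ℂ] E) (C : ℝ), CommutatorBound H A C → ∀ p : E × E,
    (∀ q ∈ A.graph, q.1 ∈ H.domain → inner ℂ q.2 p.1 = inner ℂ q.1 p.2) →
      ∃ r, (J n p.1, J n p.2 - r) ∈ A.graph ∧ ‖r‖ ≤ C * ‖p.1 - J n p.1‖

theorem mul_norm_le_of_nonneg {H : E →ₗ.[ℂ] E}
    (hpos : ∀ ψ : H.domain, 0 ≤ (inner ℂ (ψ : E) (H ψ)).re) (c : ℝ) {p : E × E}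
    (hp : p ∈ H.graph) : c * ‖p.1‖ ≤ ‖p.2 - ((-c : ℝ) : ℂ) • p.1‖ := by
  obtain ⟨x, y⟩ := p
  obtain ⟨hx, rfl⟩ := exists_apply_of_mem_graph hp
  have h1 := hpos ⟨x, hx⟩
  rcases (norm_nonneg x).eq_or_lt with h0 | h0
  · simp only [← h0, mul_zero]; positivity
  refine le_of_mul_le_mul_left ?_ h0
  have h2 : (inner ℂ x (H ⟨x, hx⟩ - ((-c : ℝ) : ℂ) • x)).re =
      (inner ℂ x (H ⟨x, hx⟩)).re + c * ‖x‖ ^ 2 := by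
    have h : (inner ℂ x x).re = ‖x‖ ^ 2 := inner_self_eq_norm_sq (𝕜 := ℂ) x
    rw [inner_sub_right, inner_smul_right, Complex.sub_re, Complex.re_ofReal_mul, h]
    ring
  have h3 := re_inner_le_norm (𝕜 := ℂ) x (H ⟨x, hx⟩ - ((-c : ℝ) : ℂ) • x)
  change (inner ℂ x (H ⟨x, hx⟩ - ((-c : ℝ) : ℂ) • x)).re ≤ _ at h3
  rw [h2] at h3
  simp only at h1 ⊢
  nlinarith

/-- The operators `J n = (n + 1) (H + n + 2)⁻¹` have the required properties. -/
theorem exists_isRegularization [CompleteSpace E] {H : E →ₗ.[ℂ] E} (hH : IsSelfAdjoint H)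
    (hpos : ∀ ψ : H.domain, 0 ≤ (inner ℂ (ψ : E) (H ψ)).re) :
    ∃ J, IsRegularization H J := by
  have hex : ∀ n : ℕ, ∃ G : E →L[ℂ] E, IsResolvent H ((-((n : ℝ) + 2) : ℝ) : ℂ) G ∧
      ∀ x, ((n : ℝ) + 2) * ‖G x‖ ≤ ‖x‖ := fun n =>
    hH.exists_resolvent (by positivity) (fun p hp => mul_norm_le_of_nonneg hpos _ hp)
      fun p hp => by rw [Complex.conj_ofReal]; exact mul_norm_le_of_nonneg hpos _ hp
  choose G hG hb using hex
  have hb1 : ∀ (n : ℕ) x, ((n : ℝ) + 1) * ‖G n x‖ ≤ ‖x‖ := fun n x =>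
    le_trans (by gcongr; norm_num) (hb n x)
  have hsub : ∀ (n : ℕ), ∀ p ∈ H.graph,
      ((n : ℝ) + 1) * ‖p.1 - ((n : ℝ) + 1) • G n p.1‖ ≤ ‖p.2 + p.1‖ := by
    intro n p hp
    have e : p.1 - ((n : ℝ) + 1) • G n p.1 = G n (p.2 + p.1) := by
      have h := (hG n).apply_sub p hp
      rw [map_sub, map_smul, Complex.coe_smul] at h
      nth_rewrite 1 [← h]
      rw [map_add]
      module
    rw [e]
    exact hb1 n _
  have htendsto : ∀ x, Tendsto (fun n : ℕ => (((n : ℝ) + 1) • G n) x) atTop (𝓝 x) := by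
    refine tendsto_of_dense hH.dense_domain (fun n x => ?_) fun x hx => ?_
    · rw [smul_apply, norm_smul, Real.norm_of_nonneg (by positivity)]
      exact hb1 n x
    · obtain ⟨y, hy⟩ := LinearPMap.mem_domain_iff.1 hx
      refine tendsto_iff_norm_sub_tendsto_zero.2 (squeeze_zero (fun _ => norm_nonneg _)
        (fun n => ?_) (tendsto_inv_succ_mul ‖y + x‖))
      rw [le_inv_mul_iff₀ (by positivity), norm_sub_rev]
      exact hsub n _ hy
  refine ⟨fun n => ((n : ℝ) + 1) • G n, htendsto, hsub, fun n x => ?_,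
    fun n A C hA p hp => ?_⟩
  · have h := H.graph.smul_mem (((n : ℝ) + 1 : ℝ) : ℂ) ((hG n).mem_graph x)
    convert h using 1
    refine Prod.ext ?_ ?_
    · simp only [smul_apply, Prod.smul_mk, Complex.coe_smul]
    · simp only [smul_apply, Prod.smul_mk, Complex.coe_smul]
      module
  · obtain ⟨r, hr, hr'⟩ := hA.resolvent hH.isFormalAdjoint (hG n) (hb1 n) hp
    refine ⟨((n : ℝ) + 1) • r, ?_, ?_⟩
    · have h := A.graph.smul_mem (((n : ℝ) + 1 : ℝ) : ℂ) hr
      convert h using 1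
      simp only [smul_apply, Prod.smul_mk, Complex.coe_smul, smul_sub]
    · rw [norm_smul, Real.norm_of_nonneg (by positivity)]
      refine hr'.trans_eq ?_
      congr 2
      rw [smul_apply, Complex.coe_smul]
      module

/-! ### Essential self-adjointness -/

/-- The adjoint of the restriction of `A` to `dom H` is contained in the closure of this
restriction: `J n p` stays close to the graph of the restriction and converges to `p`. -/
theorem CommutatorBound.mem_closure {H A : E →ₗ.[ℂ] E} {C : ℝ} (hA : CommutatorBound H A C)
    {J : ℕ → E →L[ℂ] E} (hJ : IsRegularization H J) {p : E × E}
    (hp : ∀ q ∈ A.graph, q.1 ∈ H.domain → inner ℂ q.2 p.1 = inner ℂ q.1 p.2) :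
    p ∈ closure {q : E × E | q ∈ A.graph ∧ q.1 ∈ H.domain} := by
  choose r hr hr' using fun n => hJ.commutator n A C hA p hp
  have h0 : Tendsto (fun n => C * ‖p.1 - J n p.1‖) atTop (𝓝 0) := by
    have h := ((hJ.tendsto p.1).const_sub p.1).norm.const_mul C
    rwa [sub_self, norm_zero, mul_zero] at h
  have h1 : Tendsto r atTop (𝓝 0) := squeeze_zero_norm hr' h0
  have h2 := (hJ.tendsto p.2).sub h1
  rw [sub_zero] at h2
  exact mem_closure_of_tendsto ((hJ.tendsto p.1).prodMk_nhds h2) (Eventually.of_forall fun n =>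
    ⟨hr n, LinearPMap.mem_domain_of_mem_graph (hJ.mem_graph n p.1)⟩)

theorem CommutatorBound.isEssentiallySelfAdjoint [CompleteSpace E] {H A T : E →ₗ.[ℂ] E} {C : ℝ}
    (hA : CommutatorBound H A C) (hd : Dense (H.domain : Set E))
    {J : ℕ → E →L[ℂ] E} (hJ : IsRegularization H J) (hT : T ≤ A)
    (hTA : {q : E × E | q ∈ A.graph ∧ q.1 ∈ H.domain} ⊆ closure (T.graph : Set (E × E))) :
    IsEssentiallySelfAdjoint T := by
  refine isEssentiallySelfAdjoint_of_adjoint_le ?_ ?_ fun p hp => ?_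
  · refine Dense.of_closure (hd.mono ?_)
    intro x hx
    obtain ⟨a, ha⟩ := LinearPMap.mem_domain_iff.1 (hA.le_domain hx)
    exact map_mem_closure continuous_fst (hTA ⟨ha, hx⟩)
      fun q hq => LinearPMap.mem_domain_of_mem_graph hq
  · intro x y
    exact inner_graph_of_symm hA.symm (LinearPMap.le_graph_of_le hT (LinearPMap.mem_graph T x))
      (LinearPMap.le_graph_of_le hT (LinearPMap.mem_graph T y))
  · refine closure_minimal hTA isClosed_closure (hA.mem_closure hJ fun q hq hq' => ?_)
    exact closure_minimal (t := {q : E × E | inner ℂ q.2 p.1 = inner ℂ q.1 p.2}) hp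
      (isClosed_eq (by fun_prop) (by fun_prop)) (hTA ⟨hq, hq'⟩)

theorem mem_graph_domRestrict {T : E →ₗ.[ℂ] E} {D : Submodule ℂ E} {p : E × E} :
    p ∈ (T.domRestrict D).graph ↔ p ∈ T.graph ∧ p.1 ∈ D := by
  constructor
  · intro h
    refine ⟨LinearPMap.le_graph_of_le LinearPMap.domRestrict_le h, ?_⟩
    have h := LinearPMap.mem_domain_of_mem_graph h
    exact h.1
  · obtain ⟨x, y⟩ := p
    rintro ⟨h, hD⟩
    obtain ⟨hx, rfl⟩ := exists_apply_of_mem_graph h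
    exact (LinearPMap.mem_graph_iff _).2
      ⟨⟨x, hD, hx⟩, rfl, LinearPMap.domRestrict_apply rfl⟩

/-- By the relative bound, approximation in the graph norm of `H` implies approximation in the
graph norm of `A`. -/
theorem CommutatorBound.subset_closure_domRestrict {H A : E →ₗ.[ℂ] E} {C : ℝ}
    (hA : CommutatorBound H A C) (hH : H.IsClosed) {D : Submodule ℂ E} (hD : H.HasCore D) :
    {q : E × E | q ∈ A.graph ∧ q.1 ∈ H.domain} ⊆
      closure ((A.domRestrict D).graph : Set (E × E)) := by
  rintro p ⟨hp, hp'⟩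
  obtain ⟨y, hy⟩ := LinearPMap.mem_domain_iff.1 hp'
  have hcl : (H.domRestrict D).IsClosable :=
    hH.isClosable.leIsClosable LinearPMap.domRestrict_le
  have hmem : (p.1, y) ∈ closure ((H.domRestrict D).graph : Set (E × E)) := by
    rw [← Submodule.topologicalClosure_coe, hcl.graph_closure_eq_closure_graph, hD.closure_eq]
    exact hy
  obtain ⟨u, hu, hlim⟩ := mem_closure_iff_seq_limit.1 hmem
  obtain ⟨M, hM⟩ := hA.bound
  have huH : ∀ n, u n ∈ H.graph := fun n => (mem_graph_domRestrict.1 (hu n)).1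
  choose a ha using fun n => LinearPMap.mem_domain_iff.1
    (hA.le_domain (LinearPMap.mem_domain_of_mem_graph (huH n)))
  have hle : ∀ n, ‖a n - p.2‖ ≤ M * ‖(u n - (p.1, y)).2 + (u n - (p.1, y)).1‖ := fun n =>
    hM _ (H.graph.sub_mem (huH n) hy) _ (A.graph.sub_mem (ha n) hp)
  have h0 : Tendsto (fun n => M * ‖(u n - (p.1, y)).2 + (u n - (p.1, y)).1‖) atTop (𝓝 0) := by
    have h : Continuous fun q : E × E => M * ‖(q - (p.1, y)).2 + (q - (p.1, y)).1‖ := by fun_prop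
    simpa [Function.comp_def] using (h.tendsto _).comp hlim
  have h1 : Tendsto a atTop (𝓝 p.2) :=
    tendsto_iff_norm_sub_tendsto_zero.2 (squeeze_zero (fun _ => norm_nonneg _) hle h0)
  have h2 : Tendsto (fun n => (u n).1) atTop (𝓝 p.1) := (continuous_fst.tendsto (p.1, y)).comp hlim
  exact mem_closure_of_tendsto (h2.prodMk_nhds h1) (Eventually.of_forall fun n =>
    mem_graph_domRestrict.2 ⟨ha n, (mem_graph_domRestrict.1 (hu n)).2⟩)

/-! ### Strong commutativity -/

/-- Far from the real axis, the resolvents of the closure of `A` leave `dom H` invariant. For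
`χ = (A - ic)⁻¹ φ`, the commutator bound gives
`(|c| - C) ‖χ - J n χ‖ ≤ ‖φ - J n φ‖ ≤ ‖(H + 1) φ‖ / (n + 1)`, so that
`(H + 1) J n χ = (n + 1) (χ - J n χ)` stays bounded. -/
theorem CommutatorBound.resolvent_mem_domain [CompleteSpace E] {H A : E →ₗ.[ℂ] E} {C : ℝ}
    (hA : CommutatorBound H A C) (hH : IsSelfAdjoint H)
    {J : ℕ → E →L[ℂ] E} (hJ : IsRegularization H J) (hAs : IsSelfAdjoint A.closure) {c : ℝ}
    (hc : C < |c|) {K : E →L[ℂ] E} (hK : IsResolvent A.closure (Complex.I * c) K) {x : E}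
    (hx : x ∈ H.domain) : K x ∈ H.domain := by
  obtain ⟨y, hy⟩ := LinearPMap.mem_domain_iff.1 hx
  have hle := LinearPMap.le_graph_of_le A.le_closure
  have hsub : ∀ n : ℕ, (|c| - C) * (((n : ℝ) + 1) * ‖K x - J n (K x)‖) ≤ ‖y + x‖ := by
    intro n
    obtain ⟨r, hr, hr'⟩ := hJ.commutator n A C hA _ fun q hq _ =>
      inner_graph_of_symm hAs.isFormalAdjoint (hle hq) (hK.mem_graph x)
    have h1 := abs_mul_norm_le hAs.isFormalAdjoint
      (A.closure.graph.sub_mem (hK.mem_graph x) (hle hr)) c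
    have e : ((K x, x + (Complex.I * c) • K x) - (J n (K x), J n (x + (Complex.I * c) • K x) - r)).2
        - (Complex.I * c) •
          ((K x, x + (Complex.I * c) • K x) - (J n (K x), J n (x + (Complex.I * c) • K x) - r)).1
        = (x - J n x) + r := by
      simp only [Prod.mk_sub_mk, map_add, map_smul]
      module
    rw [e] at h1
    have h2 := norm_add_le (x - J n x) r
    have h3 := hJ.norm_sub_le n _ hy
    simp only [Prod.mk_sub_mk] at h1 h2 h3 hr'
    have h4 : (|c| - C) * ‖K x - J n (K x)‖ ≤ ‖x - J n x‖ := by linarith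
    have h5 : (0 : ℝ) ≤ (n : ℝ) + 1 := by positivity
    calc _ = ((n : ℝ) + 1) * ((|c| - C) * ‖K x - J n (K x)‖) := by ring
      _ ≤ ((n : ℝ) + 1) * ‖x - J n x‖ := by gcongr
      _ ≤ _ := h3
  have hpos : 0 < |c| - C := sub_pos.2 hc
  refine hH.mem_domain_of_bound (‖y + x‖ / (|c| - C) + ‖K x‖) fun q hq => ?_
  have hlim : Tendsto (fun n => ‖(inner ℂ (J n (K x)) q.2 : ℂ)‖) atTop
      (𝓝 ‖(inner ℂ (K x) q.2 : ℂ)‖) :=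
    ((hJ.tendsto (K x)).inner tendsto_const_nhds).norm
  have hlim2 : Tendsto (fun n => (‖y + x‖ / (|c| - C) + ‖J n (K x)‖) * ‖q.1‖) atTop
      (𝓝 ((‖y + x‖ / (|c| - C) + ‖K x‖) * ‖q.1‖)) :=
    ((hJ.tendsto (K x)).norm.const_add _).mul_const _
  refine le_of_tendsto_of_tendsto' hlim hlim2 fun n => ?_
  have h1 := inner_graph_of_symm hH.isFormalAdjoint (hJ.mem_graph n (K x)) hq
  rw [← h1]
  refine (norm_inner_le_norm _ _).trans ?_
  gcongr
  refine (norm_sub_le _ _).trans (add_le_add ?_ le_rfl)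
  rw [norm_smul, Real.norm_of_nonneg (by positivity), le_div_iff₀' hpos]
  exact hsub n

/-- If `A` and `B` commute on `dom H`, then the resolvents of the closure of `A` far from the real
axis commute with the closure of `B`: on `dom H` one multiplies `AB = BA` by resolvents, and the
restriction of `B` to `dom H` is dense in the graph of its closure. -/
theorem CommutatorBound.resolvent_commutesWith [CompleteSpace E] {H A B : E →ₗ.[ℂ] E} {C C' : ℝ}
    (hA : CommutatorBound H A C) (hB : CommutatorBound H B C')
    (hH : IsSelfAdjoint H) {J : ℕ → E →L[ℂ] E} (hJ : IsRegularization H J)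
    (hAs : IsSelfAdjoint A.closure) (hBs : IsSelfAdjoint B.closure)
    (hAB : CommuteOn A B H.domain) {c : ℝ} (hc : C < |c|) {K : E →L[ℂ] E}
    (hK : IsResolvent A.closure (Complex.I * c) K) : CommutesWith K B.closure := by
  have hleA := LinearPMap.le_graph_of_le A.le_closure
  have hleB := LinearPMap.le_graph_of_le B.le_closure
  have hdom : ∀ p : E × E, p ∈ B.graph → p.1 ∈ H.domain → (K p.1, K p.2) ∈ B.graph := by
    intro p hp hp'
    have hKp := hA.resolvent_mem_domain hH hJ hAs hc hK hp'
    obtain ⟨h1, h2, h3, h4, h5⟩ := hAB _ hKp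
    have gA := LinearPMap.mem_graph A ⟨_, h1⟩
    have gB := LinearPMap.mem_graph B ⟨_, h2⟩
    have gAB := LinearPMap.mem_graph A ⟨_, h3⟩
    have gBA := LinearPMap.mem_graph B ⟨_, h4⟩
    rw [h5] at gAB
    simp only at gA gB gAB gBA
    have e1 : A ⟨_, h1⟩ = p.1 + (Complex.I * c) • K p.1 :=
      LinearPMap.mem_graph_snd_inj _ (hleA gA) (hK.mem_graph p.1) rfl
    have g := B.graph.sub_mem gBA (B.graph.smul_mem (Complex.I * c) gB)
    have e2 : B ⟨_, h4⟩ - (Complex.I * c) • B ⟨_, h2⟩ = p.2 :=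
      LinearPMap.mem_graph_snd_inj _ g hp (by simp [e1])
    have e3 := hK.apply_sub _ (hleA gAB)
    simp only [e2] at e3
    rw [e3]
    exact gB
  intro p hp
  have hp2 := hB.mem_closure hJ (p := p) fun q hq _ =>
    inner_graph_of_symm hBs.isFormalAdjoint (hleB hq) hp
  have hcl : IsClosed (B.closure.graph : Set (E × E)) := hBs.isClosed
  rw [← SetLike.mem_coe, ← hcl.closure_eq]
  exact map_mem_closure (f := fun q : E × E => (K q.1, K q.2)) (by fun_prop) hp2
    fun q hq => hleB (hdom q hq.1 hq.2)

/-- Once a resolvent `K` of the closure of `A` commutes with the closure of `B`, it commutes with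
the unitary group of the latter, which therefore commutes with the closure of `A`, hence with its
unitary group. -/
theorem CommutatorBound.stronglyCommute [CompleteSpace E] {H A B : E →ₗ.[ℂ] E} {C C' : ℝ}
    (hA : CommutatorBound H A C) (hB : CommutatorBound H B C')
    (hH : IsSelfAdjoint H) {J : ℕ → E →L[ℂ] E} (hJ : IsRegularization H J)
    (hAs : IsSelfAdjoint A.closure) (hBs : IsSelfAdjoint B.closure)
    (hAB : CommuteOn A B H.domain) : StronglyCommute A.closure B.closure := by
  obtain ⟨U, hU, hU'⟩ := exists_isUnitaryGroupOf hAs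
  obtain ⟨V, hV, hV'⟩ := exists_isUnitaryGroupOf hBs
  have hc : C < |(|C| + 1)| := by
    rw [abs_of_nonneg (by positivity)]
    linarith [le_abs_self C]
  obtain ⟨K, hK, -⟩ := hAs.exists_resolvent_I (show |C| + 1 ≠ 0 by positivity)
  have hKB := hA.resolvent_commutesWith hB hH hJ hAs hBs hAB hc hK
  refine ⟨U, V, hU, hV, fun s t => ?_⟩
  exact (hU' _ (hK.commutesWith (hV' K hKB t).symm) s).symm.eq

end UnboundedOp

theorem theoremA2 {E : Type*} [NormedAddCommGroup E] [InnerProductSpace ℂ E] [CompleteSpace E]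
    (H : E →ₗ.[ℂ] E) (hH : IsSelfAdjoint H)
    (hpos : ∀ ψ : H.domain, 0 ≤ (inner ℂ (ψ : E) (H ψ)).re) :
    (∀ A : E →ₗ.[ℂ] E, A.IsFormalAdjoint A →
      (∀ k ≤ 2, UnboundedOp.RelBounded H ((UnboundedOp.delta H)^[k] A)) →
      ∀ D : Submodule ℂ E, H.HasCore D →
        UnboundedOp.IsEssentiallySelfAdjoint (A.domRestrict D)) ∧
    (∀ A B : E →ₗ.[ℂ] E, A.IsFormalAdjoint A → B.IsFormalAdjoint B →
      (∀ k ≤ 3, UnboundedOp.RelBounded H ((UnboundedOp.delta H)^[k] A)) →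
      (∀ k ≤ 3, UnboundedOp.RelBounded H ((UnboundedOp.delta H)^[k] B)) →
      UnboundedOp.CommuteOn A B H.domain →
      (∀ D : Submodule ℂ E, H.HasCore D →
        UnboundedOp.IsEssentiallySelfAdjoint (A.domRestrict D) ∧
        UnboundedOp.IsEssentiallySelfAdjoint (B.domRestrict D)) ∧
      UnboundedOp.StronglyCommute A.closure B.closure) := by
  obtain ⟨J, hJ⟩ := UnboundedOp.exists_isRegularization hH hpos
  have hd := hH.dense_domain
  have hcore : ∀ {A : E →ₗ.[ℂ] E} {C : ℝ}, UnboundedOp.CommutatorBound H A C →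
      ∀ D : Submodule ℂ E, H.HasCore D →
        UnboundedOp.IsEssentiallySelfAdjoint (A.domRestrict D) := fun hA D hD =>
    hA.isEssentiallySelfAdjoint hd hJ LinearPMap.domRestrict_le
      (hA.subset_closure_domRestrict hH.isClosed hD)
  have hself : ∀ {A : E →ₗ.[ℂ] E} {C : ℝ}, UnboundedOp.CommutatorBound H A C →
      IsSelfAdjoint A.closure := fun hA =>
    (hA.isEssentiallySelfAdjoint hd hJ le_rfl fun _ hq => subset_closure hq.1).2
  refine ⟨fun A hA hrel => ?_, fun A B hA hB hrelA hrelB hAB => ?_⟩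
  · obtain ⟨C, hAC⟩ := UnboundedOp.CommutatorBound.of_relBounded hd hA
      (hrel 0 (by norm_num)) (hrel 1 (by norm_num))
    exact hcore hAC
  · obtain ⟨C, hAC⟩ := UnboundedOp.CommutatorBound.of_relBounded hd hA
      (hrelA 0 (by norm_num)) (hrelA 1 (by norm_num))
    obtain ⟨C', hBC⟩ := UnboundedOp.CommutatorBound.of_relBounded hd hB
      (hrelB 0 (by norm_num)) (hrelB 1 (by norm_num))
    exact ⟨fun D hD => ⟨hcore hAC D hD, hcore hBC D hD⟩,
      hAC.stronglyCommute hBC hH hJ (hself hAC) (hself hBC) hAB⟩
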